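/- Let $\mathbb{F}_q$ be the finite field with $q$ elements, and equip $\mathbb{F}_q^{2n}$ with the symplectic inner product $\langle \mathbf{x},\mathbf{y}\rangle_{\mathrm s}=\sum_{i=1}^n (x_i y_{n+i}-x_{n+i}y_i)$. A symplectic LCD $[2n,2k]_q$ code is a $2k$-dimensional $\mathbb{F}_q$-subspace $C\subseteq\mathbb{F}_q^{2n}$ with $C\cap C^{\perp_{\mathrm s}}=\{\mathbf 0\}$, where $C^{\perp_{\mathrm s}}=\{\mathbf y\in\mathbb{F}_q^{2n} : \langle \mathbf x,\mathbf y\rangle_{\mathrm s}=0 \text{ for all } \mathbf x\in C\}$. Let $\mathrm{SLCD}[2n,2k]_q$ be the set of all such codes. Then for all integers $n,k$ with $0<k<n$, $$|\mathrm{SLCD}[2n,2k]_q| \;=\; q^{2k(n-k)}\begin{bmatrix} n\\ k\end{bmatrix}_{q^2} \;=\; \frac{|\mathrm{Sp}_{2n}(q)|}{|\mathrm{Sp}_{2k}(q)|\cdot|\mathrm{Sp}_{2n-2k}(q)|},$$ where $\begin{bmatrix} n\\ k\end{bmatrix}_{Q}=\prod_{i=0}^{k-1}\frac{Q^n-Q^i}{Q^k-Q^i}$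 is the Gaussian binomial coefficient, and $\mathrm{Sp}_{2m}(q)$ is the group of $2m\times 2m$ matrices $A$ over $\mathbb{F}_q$ with $A\Omega_m A^T=\Omega_m$, $\Omega_m=\begin{pmatrix} O& I_m\\ -I_m& O\end{pmatrix}$. -/

import Mathlib

namespace SympCode

/-- A vector of length `2n` over `F` is written `(x | y)`: its first `n` coordinates are indexed by
`Sum.inl i`, its last `n` coordinates by `Sum.inr i`. -/
abbrev Word (F : Type*) (n : ℕ) : Type _ := Fin n ⊕ Fin n → F

/-- The symplectic inner product `∑ i, (x_i y_{n+i} - x_{n+i} y_i)` on `F^{2n}`. -/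
def inner {F : Type*} [Field F] {n : ℕ} (x y : Word F n) : F :=
  ∑ i : Fin n, (x (Sum.inl i) * y (Sum.inr i) - x (Sum.inr i) * y (Sum.inl i))

/-- The symplectic dual code of a linear code `C` of length `2n`. -/
def dual {F : Type*} [Field F] {n : ℕ} (C : Submodule F (Word F n)) : Submodule F (Word F n) where
  carrier := {y | ∀ x ∈ C, inner x y = 0}
  zero_mem' := by
    intro x _
    simp [inner]
  add_mem' := by
    intro a b ha hb x hx
    have h : inner x (a + b) = inner x a + inner x b := by
      simp only [inner, Pi.add_apply, ← Finset.sum_add_distrib]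
      exact Finset.sum_congr rfl fun i _ => by ring
    rw [h, ha x hx, hb x hx, add_zero]
  smul_mem' := by
    intro c a ha x hx
    have h : inner x (c • a) = c * inner x a := by
      simp only [inner, Pi.smul_apply, smul_eq_mul, Finset.mul_sum]
      exact Finset.sum_congr rfl fun i _ => by ring
    rw [h, ha x hx, mul_zero]

/-- A linear code is symplectic LCD if it meets its symplectic dual trivially. -/
def IsLCD {F : Type*} [Field F] {n : ℕ} (C : Submodule F (Word F n)) : Prop :=
  C ⊓ dual C = ⊥

/-- The set of all symplectic LCD `[2n, d]` codes over `F`. -/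
def lcdCodes (F : Type*) [Field F] (n d : ℕ) : Set (Submodule F (Word F n)) :=
  {C | Module.finrank F C = d ∧ IsLCD C}

/-- The Gaussian binomial coefficient, as the quotient
`(q^n-1)(q^n-q)⋯(q^n-q^{k-1}) / ((q^k-1)(q^k-q)⋯(q^k-q^{k-1}))`; it is `1` for `k = 0`. -/
def gaussBinom (n k : ℕ) (q : ℚ) : ℚ :=
  (∏ i ∈ Finset.range k, (q ^ n - q ^ i)) / ∏ i ∈ Finset.range k, (q ^ k - q ^ i)

end SympCode

/-! Double counting of symplectic frames, the families of 2k vectors with Gram matrix `J`. Since `J`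
is invertible, a frame spans a 2k-dimensional LCD code; conversely such a code is itself a
nondegenerate symplectic space, whose number of frames depends only on its dimension. Hence the
frames of length 2k in F^{2n} number (LCD codes) × (frames of a 2k-space): `frameCount_eq_mul`.
Frames are counted by adding one hyperbolic pair at a time inside the orthogonal complement
(`natCard_frames`). Full-length frames are the symplectic matrices, so both formulas reduce to
identities for `frameCount`. -/

namespace SympCode

open Matrix Module

/-! ### Fibre counting and hyperbolic pairs. -/

section Counting

theorem natCard_eq_mul_of_fiber {α β : Type*} [Finite α] [Finite β] (f : α → β) (c : ℕ)
    (h : ∀ b, Nat.card {a // f a = b} = c) : Nat.card α = Nat.card β * c := by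
  have := Fintype.ofFinite β
  rw [← Nat.card_congr (Equiv.sigmaFiberEquiv f), Nat.card_sigma]
  simp [h]

variable {F V : Type*} [Field F] [AddCommGroup V] [Module F V] [FiniteDimensional F V]

theorem natCard_fiber_of_ne_zero {f : V →ₗ[F] F} (hf : f ≠ 0) (c : F) :
    Nat.card {y // f y = c} = Nat.card F ^ (finrank F V - 1) := by
  obtain ⟨y₀, hy₀⟩ := LinearMap.surjective hf c
  let e : {y // f y = c} ≃ LinearMap.ker f :=
    { toFun y := ⟨y.1 - y₀, by simp [y.2, hy₀]⟩
      invFun z := ⟨z.1 + y₀, by simp [hy₀]⟩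
      left_inv y := by simp
      right_inv z := by simp }
  have hr := f.finrank_range_add_finrank_ker
  rw [LinearMap.range_eq_top.mpr (LinearMap.surjective hf), finrank_top, finrank_self] at hr
  rw [Nat.card_congr e, Module.natCard_eq_pow_finrank (K := F)]
  congr 1
  omega

/-- For each x ≠ 0 the functional `B x` is nonzero, so its fibre over `c` is an affine hyperplane; x
= 0 contributes nothing because `c ≠ 0`. -/
theorem natCard_pairs [Finite F] {B : LinearMap.BilinForm F V} (hB : B.Nondegenerate) {c : F} (hc : c ≠ 0) :
    Nat.card {p : V × V // B p.1 p.2 = c} =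
      (Nat.card F ^ finrank F V - 1) * Nat.card F ^ (finrank F V - 1) := by
  classical
  have : Finite V := Module.finite_of_finite F
  have := Fintype.ofFinite V
  have h0 (x : V) : Nat.card {y // B x y = c} =
      if x = 0 then 0 else Nat.card F ^ (finrank F V - 1) := by
    split_ifs with hx
    · simp [hx, hc.symm]
    · refine natCard_fiber_of_ne_zero (fun h => hx ?_) c
      exact hB.1 x fun y => by rw [h, LinearMap.zero_apply]
  let e : {p : V × V // B p.1 p.2 = c} ≃ Σ x : V, {y // B x y = c} :=
    { toFun p := ⟨p.1.1, p.1.2, p.2⟩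
      invFun s := ⟨(s.1, s.2.1), s.2.2⟩
      left_inv _ := rfl
      right_inv _ := rfl }
  rw [Nat.card_congr e, Nat.card_sigma]
  simp_rw [h0]
  rw [Finset.sum_ite, Finset.sum_const_zero, zero_add, Finset.sum_const, smul_eq_mul,
    Finset.filter_ne', Finset.card_erase_of_mem (Finset.mem_univ _), Finset.card_univ,
    ← Nat.card_eq_fintype_card, Module.natCard_eq_pow_finrank (K := F)]

end Counting

section Pairs

variable {V : Type*} {k : ℕ}

/-- Prepending a pair of vectors to a family indexed by `Fin k ⊕ Fin k`. -/
def consPair (p : V × V) (v : Fin k ⊕ Fin k → V) : Fin (k + 1) ⊕ Fin (k + 1) → V :=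
  Sum.elim (Fin.cons p.1 (v ∘ Sum.inl)) (Fin.cons p.2 (v ∘ Sum.inr))

/-- Splitting off the first pair of a family indexed by `Fin (k + 1) ⊕ Fin (k + 1)`. -/
def tailPairs (w : Fin (k + 1) ⊕ Fin (k + 1) → V) : Fin k ⊕ Fin k → V :=
  w ∘ Sum.map Fin.succ Fin.succ

@[simp]
theorem tailPairs_consPair (p : V × V) (v : Fin k ⊕ Fin k → V) :
    tailPairs (consPair p v) = v := by
  ext (i | i) <;> simp [tailPairs, consPair]

theorem consPair_tailPairs (w : Fin (k + 1) ⊕ Fin (k + 1) → V) :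
    consPair (w (Sum.inl 0), w (Sum.inr 0)) (tailPairs w) = w := by
  ext (i | i) <;> refine Fin.cases ?_ (fun j => ?_) i <;> simp [tailPairs, consPair]

end Pairs

/-! ### Symplectic frames and the codes they span. -/

section Frames

variable {F V : Type*} [Field F] [AddCommGroup V] [Module F V]

/-- A symplectic frame of length `2k`: a family of vectors with Gram matrix `J`. -/
def IsFrame (B : LinearMap.BilinForm F V) {k : ℕ} (v : Fin k ⊕ Fin k → V) : Prop :=
  ∀ a b, B (v a) (v b) = J (Fin k) F a b

variable {B : LinearMap.BilinForm F V} {k : ℕ} {v : Fin k ⊕ Fin k → V}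

/-- The products with the frame form the vector `c ᵥ* J`, and `J` is invertible. This yields both
linear independence and the LCD property of the span. -/
theorem IsFrame.eq_zero_of_orthogonal (hv : IsFrame B v) {c : Fin k ⊕ Fin k → F}
    (h : ∀ b, B (∑ a, c a • v a) (v b) = 0) : c = 0 := by
  have hJ : c ᵥ* J (Fin k) F = 0 := by
    ext b
    simpa [hv _ b, Matrix.vecMul, dotProduct] using h b
  exact Matrix.eq_zero_of_vecMul_eq_zero (Matrix.isUnit_det_J (Fin k) F).ne_zero hJ

theorem IsFrame.linearIndependent (hv : IsFrame B v) : LinearIndependent F v :=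
  Fintype.linearIndependent_iff.mpr fun c hc =>
    congrFun (hv.eq_zero_of_orthogonal fun b => by rw [hc, LinearMap.map_zero₂])

theorem IsFrame.finrank_span (hv : IsFrame B v) :
    finrank F (Submodule.span F (Set.range v)) = 2 * k := by
  rw [finrank_span_eq_card hv.linearIndependent, Fintype.card_sum, Fintype.card_fin, two_mul]

theorem IsFrame.disjoint_orthogonal (hv : IsFrame B v) (hB : B.IsRefl) :
    Disjoint (Submodule.span F (Set.range v)) (B.orthogonal (Submodule.span F (Set.range v))) := by
  rw [Submodule.disjoint_def]
  intro x hx hx'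
  obtain ⟨c, rfl⟩ := (Submodule.mem_span_range_iff_exists_fun F).mp hx
  rw [hv.eq_zero_of_orthogonal fun b => hB _ _ (hx' (v b) (Submodule.subset_span ⟨b, rfl⟩))]
  simp

theorem mem_orthogonal_span_range {x : V} :
    x ∈ B.orthogonal (Submodule.span F (Set.range v)) ↔ ∀ a, B (v a) x = 0 := by
  refine ⟨fun h a => h _ (Submodule.subset_span ⟨a, rfl⟩), fun h y hy => ?_⟩
  obtain ⟨c, rfl⟩ := (Submodule.mem_span_range_iff_exists_fun F).mp hy
  simp [h]

theorem IsFrame.tail {w : Fin (k + 1) ⊕ Fin (k + 1) → V} (hw : IsFrame B w) :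
    IsFrame B (tailPairs w) := by
  rintro (i | i) (j | j) <;> simp [tailPairs, hw _ _, J, Matrix.one_apply]

/-- The value -1 is the `inl`-`inr` diagonal entry of `J`. -/
theorem isFrame_consPair (hB : B.IsAlt) {p : V × V} (hv : IsFrame B v) :
    IsFrame B (consPair p v) ↔ B p.1 p.2 = -1 ∧
      p.1 ∈ B.orthogonal (Submodule.span F (Set.range v)) ∧
      p.2 ∈ B.orthogonal (Submodule.span F (Set.range v)) := by
  simp only [mem_orthogonal_span_range]
  constructor
  · intro h
    refine ⟨by simpa [consPair, J] using h (Sum.inl 0) (Sum.inr 0), ?_, ?_⟩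
    · rintro (i | i)
      · simpa [consPair, J] using h (Sum.inl i.succ) (Sum.inl 0)
      · simpa [consPair, J] using h (Sum.inr i.succ) (Sum.inl 0)
    · rintro (i | i)
      · simpa [consPair, J] using h (Sum.inl i.succ) (Sum.inr 0)
      · simpa [consPair, J] using h (Sum.inr i.succ) (Sum.inr 0)
  · rintro ⟨h, h₁, h₂⟩
    have h' : B p.2 p.1 = 1 := by rw [← LinearMap.BilinForm.IsAlt.neg_eq hB, h, neg_neg]
    have h₁' : ∀ a, B p.1 (v a) = 0 := fun a => hB.isRefl _ _ (h₁ a)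
    have h₂' : ∀ a, B p.2 (v a) = 0 := fun a => hB.isRefl _ _ (h₂ a)
    rintro (i | i) (j | j) <;> refine Fin.cases ?_ (fun i => ?_) i <;>
      refine Fin.cases ?_ (fun j => ?_) j <;>
      simp [consPair, J, h, h', h₁, h₂, h₁', h₂', hB _, hv _ _, Matrix.one_apply,
        (Fin.succ_ne_zero _).symm]

variable [FiniteDimensional F V]

/-- Frames extending a frame `v` by a pair correspond to pairs in the orthogonal of `v`. -/
def tailFiberEquiv (hB : B.IsAlt) (v : {v : Fin k ⊕ Fin k → V // IsFrame B v}) :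
    {w : {w : Fin (k + 1) ⊕ Fin (k + 1) → V // IsFrame B w} //
      (⟨tailPairs w.1, w.2.tail⟩ : {v : Fin k ⊕ Fin k → V // IsFrame B v}) = v} ≃
    {p : B.orthogonal (Submodule.span F (Set.range v.1)) ×
        B.orthogonal (Submodule.span F (Set.range v.1)) //
      B.restrict (B.orthogonal (Submodule.span F (Set.range v.1))) p.1 p.2 = -1} where
  toFun w :=
    have h := (isFrame_consPair hB v.2 (p := (w.1.1 (Sum.inl 0), w.1.1 (Sum.inr 0)))).mp <| by
      obtain ⟨w, rfl⟩ := w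
      simpa only [consPair_tailPairs] using w.2
    ⟨(⟨_, h.2.1⟩, ⟨_, h.2.2⟩), h.1⟩
  invFun p := ⟨⟨consPair (p.1.1.1, p.1.2.1) v.1,
    (isFrame_consPair hB v.2).mpr ⟨p.2, p.1.1.2, p.1.2.2⟩⟩, Subtype.ext (by simp)⟩
  left_inv w := by
    obtain ⟨w, rfl⟩ := w
    exact Subtype.ext (Subtype.ext (consPair_tailPairs _))
  right_inv p := rfl

/-- The number of symplectic frames of length `2k` in a symplectic space of dimension `d`
over a field with `q` elements. -/
def frameCount (q d k : ℕ) : ℕ :=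
  ∏ i ∈ Finset.range k, (q ^ (d - 2 * i) - 1) * q ^ (d - 2 * i - 1)

/-- No bound on `k` is needed: if 2i ≥ dim V for some i < k, no frame exists, and the truncated
exponent gives the factor q^0 - 1 = 0. -/
theorem natCard_frames [Finite F] (hB : B.IsAlt) (hB' : B.Nondegenerate) (k : ℕ) :
    Nat.card {v : Fin k ⊕ Fin k → V // IsFrame B v} =
      frameCount (Nat.card F) (finrank F V) k := by
  have : Finite V := Module.finite_of_finite F
  induction k with
  | zero =>
    have : Unique {v : Fin 0 ⊕ Fin 0 → V // IsFrame B v} :=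
      { default := ⟨isEmptyElim, isEmptyElim⟩
        uniq v := Subtype.ext (Subsingleton.elim _ _) }
    simp [frameCount]
  | succ k ih =>
    rw [natCard_eq_mul_of_fiber (fun w : {w : Fin (k + 1) ⊕ Fin (k + 1) → V // IsFrame B w} =>
      (⟨tailPairs w.1, w.2.tail⟩ : {v : Fin k ⊕ Fin k → V // IsFrame B v})), ih, frameCount,
      frameCount, Finset.prod_range_succ]
    intro v
    have hd := v.2.disjoint_orthogonal hB.isRefl
    have hnd : (B.restrict (B.orthogonal (Submodule.span F (Set.range v.1)))).Nondegenerate := by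
      -- The complement of the span has the span as its own orthogonal, so it meets that orthogonal
      -- trivially.
      refine LinearMap.BilinForm.nondegenerate_restrict_of_disjoint_orthogonal B hB.isRefl ?_
      rw [LinearMap.BilinForm.orthogonal_orthogonal hB' hB.isRefl]
      exact hd.symm
    rw [Nat.card_congr (tailFiberEquiv hB v), natCard_pairs hnd (neg_ne_zero.mpr one_ne_zero),
      LinearMap.BilinForm.finrank_orthogonal hB', v.2.finrank_span]

/-- The frames spanning a given `2k`-dimensional subspace are the frames of that subspace. -/
def spanFiberEquiv {C : Submodule F V} (hC : finrank F C = 2 * k) :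
    {v : {v : Fin k ⊕ Fin k → V // IsFrame B v} // Submodule.span F (Set.range v.1) = C} ≃
      {v : Fin k ⊕ Fin k → C // IsFrame (B.restrict C) v} where
  toFun v := ⟨fun a => ⟨v.1.1 a, v.2.le (Submodule.subset_span ⟨a, rfl⟩)⟩, fun a b => v.1.2 a b⟩
  invFun v :=
    have hv : IsFrame B (fun a => (v.1 a : V)) := fun a b => v.2 a b
    ⟨⟨fun a => v.1 a, hv⟩, Submodule.eq_of_le_of_finrank_eq
      (Submodule.span_le.mpr (by rintro _ ⟨a, rfl⟩; exact (v.1 a).2))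
      (hv.finrank_span.trans hC.symm)⟩
  left_inv v := rfl
  right_inv v := rfl

theorem frameCount_eq_mul [Finite F] (hB : B.IsAlt) (hB' : B.Nondegenerate) (k : ℕ) :
    frameCount (Nat.card F) (finrank F V) k =
      {C : Submodule F V | finrank F C = 2 * k ∧ Disjoint C (B.orthogonal C)}.ncard *
        frameCount (Nat.card F) (2 * k) k := by
  have : Finite V := Module.finite_of_finite F
  rw [← natCard_frames hB hB', ← Nat.card_coe_set_eq]
  refine natCard_eq_mul_of_fiber (fun v => ⟨Submodule.span F (Set.range v.1),
    v.2.finrank_span, v.2.disjoint_orthogonal hB.isRefl⟩) _ ?_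
  rintro ⟨C, hC, hd⟩
  simp only [Subtype.mk.injEq]
  -- The LCD condition makes the restricted form nondegenerate, so every fibre has the same size.
  rw [Nat.card_congr (spanFiberEquiv hC), natCard_frames (B := B.restrict C) (fun x => hB x)
    (B.nondegenerate_restrict_of_disjoint_orthogonal hB.isRefl hd), hC]

end Frames

/-! ### The standard symplectic space and its group. -/

section Standard

variable (F : Type*) [Field F] (n : ℕ)

/-- The standard alternating form on `F^{2n}`, with Gram matrix `J`. -/
def stdForm : LinearMap.BilinForm F (Word F n) := Matrix.toBilin' (J (Fin n) F)

variable {F n}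

/-- `J` carries -1 in its upper right block, hence the sign; orthogonality is unaffected. -/
theorem stdForm_apply (x y : Word F n) : stdForm F n x y = -inner x y := by
  simp only [stdForm, Matrix.toBilin'_apply', inner, J, dotProduct, Fintype.sum_sum_type,
    Matrix.fromBlocks_mulVec, Sum.elim_inl, Sum.elim_inr, Matrix.zero_mulVec, Matrix.neg_mulVec,
    Matrix.one_mulVec, zero_add, add_zero, Pi.neg_apply, Function.comp_apply,
    ← Finset.sum_add_distrib, ← Finset.sum_neg_distrib]
  exact Finset.sum_congr rfl fun i _ => by ring

theorem stdForm_isAlt : (stdForm F n).IsAlt := fun x => by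
  rw [stdForm_apply, neg_eq_zero]
  exact Finset.sum_eq_zero fun i _ => by ring

theorem stdForm_nondegenerate : (stdForm F n).Nondegenerate :=
  LinearMap.BilinForm.nondegenerate_toBilin'_of_det_ne_zero' _ (isUnit_det_J (Fin n) F).ne_zero

theorem orthogonal_stdForm (C : Submodule F (Word F n)) :
    (stdForm F n).orthogonal C = dual C := by
  ext y
  exact forall₂_congr fun x _ => by rw [stdForm_apply, neg_eq_zero]

/-- The entries of A J Aᵀ are the values of the form on pairs of rows of A. -/
theorem isFrame_stdForm_iff {A : Matrix (Fin n ⊕ Fin n) (Fin n ⊕ Fin n) F} :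
    IsFrame (stdForm F n) A ↔ A ∈ symplecticGroup (Fin n) F := by
  rw [SymplecticGroup.mem_iff, ← Matrix.ext_iff]
  refine forall₂_congr fun a b => ?_
  rw [stdForm, Matrix.toBilin'_apply', Matrix.dotProduct_mulVec]
  rfl

theorem finrank_word : finrank F (Word F n) = 2 * n := by
  simp [two_mul]

variable [Finite F]

theorem natCard_symplecticGroup :
    Nat.card (symplecticGroup (Fin n) F) = frameCount (Nat.card F) (2 * n) n := by
  rw [← finrank_word (F := F), ← natCard_frames stdForm_isAlt stdForm_nondegenerate]
  exact Nat.card_congr (Equiv.subtypeEquivRight fun A => isFrame_stdForm_iff.symm)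

theorem frameCount_eq_ncard_lcdCodes_mul (k : ℕ) :
    frameCount (Nat.card F) (2 * n) k =
      (lcdCodes F n (2 * k)).ncard * frameCount (Nat.card F) (2 * k) k := by
  rw [← finrank_word (F := F), frameCount_eq_mul stdForm_isAlt stdForm_nondegenerate]
  simp only [orthogonal_stdForm, disjoint_iff]
  rfl

end Standard

/-! ### Product identities for the frame count. -/

section Arithmetic

/-- After k pairs, the remaining factors count full frames of the 2m-dimensional complement. -/
theorem frameCount_add (q m k : ℕ) :
    frameCount q (2 * (k + m)) (k + m) =
      frameCount q (2 * (k + m)) k * frameCount q (2 * m) m := by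
  simp only [frameCount, Finset.prod_range_add]
  congr 1
  refine Finset.prod_congr rfl fun i _ => ?_
  rw [show 2 * (k + m) - 2 * (k + i) = 2 * m - 2 * i by omega]

theorem frameCount_pos {q d k : ℕ} (hq : 1 < q) (hd : 2 * k ≤ d) : 0 < frameCount q d k := by
  refine Finset.prod_pos fun i hi => Nat.mul_pos (Nat.sub_pos_of_lt ?_) (Nat.pow_pos (by omega))
  have := Finset.mem_range.mp hi
  exact Nat.one_lt_pow (by omega) hq

theorem frameCount_cast {q n k : ℕ} (hq : 1 < q) (hk : k ≤ n) :
    (frameCount q (2 * n) k : ℚ) =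
      (q : ℚ) ^ (2 * k * (n - k)) * gaussBinom n k ((q : ℚ) ^ 2) * frameCount q (2 * k) k := by
  have hq0 : (0 : ℚ) < q := by positivity
  have hq2 : (1 : ℚ) < (q : ℚ) ^ 2 := one_lt_pow₀ (by exact_mod_cast hq) two_ne_zero
  rw [gaussBinom, ← Finset.prod_div_distrib, show 2 * k * (n - k) = 2 * (n - k) * k by ring,
    pow_mul, ← Finset.card_range k, ← Finset.prod_const, Finset.card_range, frameCount,
    frameCount, Nat.cast_prod, Nat.cast_prod, ← Finset.prod_mul_distrib,
    ← Finset.prod_mul_distrib]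
  -- In the i-th factor the pure powers of q have ratio q^{2(n-k)}, and the rest is the i-th
  -- Gaussian factor with q^{2i} cancelled.
  refine Finset.prod_congr rfl fun i hi => ?_
  have hi := Finset.mem_range.mp hi
  obtain ⟨j, rfl⟩ := Nat.exists_eq_add_of_lt hi
  obtain ⟨m, rfl⟩ := Nat.exists_eq_add_of_le hk
  have hne : ((q : ℚ) ^ 2) ^ (j + 1) - 1 ≠ 0 := (sub_pos.mpr (one_lt_pow₀ hq2 (by omega))).ne'
  rw [show 2 * (i + j + 1 + m) - 2 * i = 2 * (j + 1 + m) by omega,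
    show 2 * (i + j + 1) - 2 * i = 2 * (j + 1) by omega,
    show i + j + 1 + m - (i + j + 1) = m by omega,
    show 2 * (j + 1 + m) - 1 = 2 * m + (2 * (j + 1) - 1) by omega,
    Nat.cast_mul, Nat.cast_mul, Nat.cast_sub (Nat.one_le_pow _ _ (by omega)),
    Nat.cast_sub (Nat.one_le_pow _ _ (by omega)),
    show i + j + 1 + m = i + (j + 1 + m) by omega, show i + j + 1 = i + (j + 1) by omega,
    pow_add _ i (j + 1 + m), pow_add _ i (j + 1), ← mul_sub_one, ← mul_sub_one,
    mul_div_mul_left _ _ (pow_pos (pow_pos hq0 2) i).ne']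
  push_cast
  rw [pow_mul (q : ℚ) 2 (j + 1 + m), pow_mul (q : ℚ) 2 (j + 1), pow_add]
  field_simp
  ring

end Arithmetic

end SympCode

theorem theorem4p9 {F : Type*} [Field F] [Fintype F] (q : ℕ) (hq : Fintype.card F = q)
    (n k : ℕ) (hk : 0 < k) (hkn : k < n) :
    ((SympCode.lcdCodes F n (2 * k)).ncard : ℚ) =
        (q : ℚ) ^ (2 * k * (n - k)) * SympCode.gaussBinom n k ((q : ℚ) ^ 2) ∧
      ((SympCode.lcdCodes F n (2 * k)).ncard : ℚ) =
        (Nat.card (Matrix.symplecticGroup (Fin n) F) : ℚ) /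
          ((Nat.card (Matrix.symplecticGroup (Fin k) F) : ℚ) *
            (Nat.card (Matrix.symplecticGroup (Fin (n - k)) F) : ℚ)) := by
  have hq1 : 1 < q := hq ▸ Fintype.one_lt_card
  have hcard : Nat.card F = q := Nat.card_eq_fintype_card.trans hq
  have hcount := SympCode.frameCount_eq_ncard_lcdCodes_mul (F := F) (n := n) k
  have hpos {m : ℕ} : (SympCode.frameCount q (2 * m) m : ℚ) ≠ 0 :=
    Nat.cast_ne_zero.mpr (SympCode.frameCount_pos hq1 le_rfl).ne'
  rw [hcard] at hcount
  constructor
  · refine mul_right_cancel₀ (hpos (m := k)) ?_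
    rw [← SympCode.frameCount_cast hq1 hkn.le, hcount, Nat.cast_mul]
  · obtain ⟨m, rfl⟩ := Nat.exists_eq_add_of_le hkn.le
    simp only [SympCode.natCard_symplecticGroup, hcard, Nat.add_sub_cancel_left]
    -- Here |Sp_{2n}| = (frames of length 2k) · |Sp_{2m}|, and those frames number (codes) ·
    -- |Sp_{2k}|.
    rw [eq_div_iff (mul_ne_zero hpos hpos), SympCode.frameCount_add, hcount]
    push_cast
    ring
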